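/- Let $X$ be a complex Banach space with open unit ball $B_X$. Let $\mathcal HL_0(B_X)$ be the space of all bounded holomorphic Lipschitz functions $f\colon B_X\to\mathbb C$ with $f(0)=0$, normed by the Lipschitz constant $L(f)=\sup\{|f(x)-f(y)|/\|x-y\| : x\ne y\in B_X\}$ (with $L(f)=0$ if $X=\{0\}$). Let $\tau_0$ be the compact-open topology on $\mathcal HL_0(B_X)$, and let $$\mathcal G_0(B_X)=\{\varphi\in \mathcal HL_0(B_X)^* : \varphi \text{ is } \tau_0\text{-continuous on the closed unit ball of } \mathcal HL_0(B_X)\},$$ with the norm of $\mathcal HL_0(B_X)^*$. Let $\delta\colon B_X\to\mathcal G_0(B_X)$ be given by $\delta(x)(f)=f(x)$. Then $\delta$ is (complex Fréchet) differentiable at $0$, and its derivative $d\delta(0)\colon X\to\mathcal G_0(B_X)$ is a linear isometry onto its image: $\|d\delta(0)(x)\|=\|x\|$ for all $x\in X$. There is a unique bounded linear operator $T_{Id}\colon\mathcal G_0(B_X)\to X$ with $T_{Id}(\delta(x))=x$ for all $x\in B_X$, and $P=d\delta(0)\circ T_{Id}$ satisfies $P^2=P$, $P(\mathcal G_0(B_X))=d\delta(0)(X)$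 and $\|P\|\le 1$, with $\|P\|=1$ if $X\neq\{0\}$. In particular, $X$ is isometric to the $1$-complemented subspace $d\delta(0)(X)$ of $\mathcal G_0(B_X)$. -/

import Mathlib

open Metric Set

set_option linter.unusedSectionVars false
set_option maxSynthPendingDepth 3

noncomputable section

namespace HolLip

variable (X Y : Type*) [NormedAddCommGroup X] [NormedSpace ℂ X]
  [NormedAddCommGroup Y] [NormedSpace ℂ Y]

/-- The open unit ball `B_X`, as a type. -/
abbrev UBall : Type _ := ↥(ball (0 : X) 1)

/-- The centre of the open unit ball. -/
def UBall.zero : UBall X := ⟨0, mem_ball_self one_pos⟩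

variable {X Y}

/-- Extension by `0` of a map on the unit ball to the whole space. Since the ball is open, this
does not affect differentiability or derivatives at points of the ball. -/
def ext (f : UBall X → Y) : X → Y := Function.extend Subtype.val f 0

theorem ext_apply (f : UBall X → Y) (x : UBall X) : ext f x = f x :=
  Subtype.val_injective.extend_apply f 0 x

theorem ext_zero : ext (0 : UBall X → Y) = 0 := Function.extend_zero Subtype.val

theorem ext_add (f g : UBall X → Y) : ext (f + g) = ext f + ext g := by
  have h := Function.extend_add (Subtype.val : UBall X → X) f g 0 0
  simpa [ext] using h

theorem ext_smul (c : ℂ) (f : UBall X → Y) : ext (c • f) = c • ext f := by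
  have h := Function.extend_smul c (Subtype.val : UBall X → X) f 0
  simpa [ext] using h

variable (X Y)

/-- `Lip_0(B_X, Y)`: the Lipschitz maps on the open unit ball that vanish at `0`. -/
def Lip0 : Submodule ℂ (UBall X → Y) where
  carrier := {f | f (UBall.zero X) = 0 ∧ ∃ K, LipschitzWith K f}
  zero_mem' := ⟨rfl, 0, LipschitzWith.const 0⟩
  add_mem' := by
    rintro f g ⟨hf, K, hK⟩ ⟨hg, M, hM⟩
    exact ⟨by simp [hf, hg], K + M, hK.add hM⟩
  smul_mem' := by
    rintro c f ⟨hf, K, hK⟩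
    refine ⟨by simp [hf], ‖c‖₊ * K, ?_⟩
    exact (lipschitzWith_smul c).comp hK

/-- `H^∞(B_X, Y)`: the bounded holomorphic maps on the open unit ball. -/
def HInf : Submodule ℂ (UBall X → Y) where
  carrier := {f | DifferentiableOn ℂ (ext f) (ball 0 1) ∧ ∃ C, ∀ x, ‖f x‖ ≤ C}
  zero_mem' := ⟨by rw [ext_zero]; exact differentiableOn_const 0, 0, fun x => by simp⟩
  add_mem' := by
    rintro f g ⟨hf, C, hC⟩ ⟨hg, D, hD⟩
    exact ⟨by rw [ext_add]; exact hf.add hg, C + D,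
      fun x => (norm_add_le _ _).trans (add_le_add (hC x) (hD x))⟩
  smul_mem' := by
    rintro c f ⟨hf, C, hC⟩
    refine ⟨by rw [ext_smul]; exact hf.const_smul c, ‖c‖ * C, fun x => ?_⟩
    rw [Pi.smul_apply, norm_smul]
    exact mul_le_mul_of_nonneg_left (hC x) (norm_nonneg c)

/-- `HL_0(B_X) = Lip_0(B_X, ℂ) ∩ H^∞(B_X, ℂ)`. It is a type of its own so that it does not
carry the topology of pointwise convergence; its norm is the Lipschitz constant (see below). -/
def HL0 : Type _ := ↥(Lip0 X ℂ ⊓ HInf X ℂ)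

namespace HL0

instance : AddCommGroup (HL0 X) := inferInstanceAs (AddCommGroup ↥(Lip0 X ℂ ⊓ HInf X ℂ))

instance : Module ℂ (HL0 X) := inferInstanceAs (Module ℂ ↥(Lip0 X ℂ ⊓ HInf X ℂ))

variable {X}

instance : CoeFun (HL0 X) (fun _ => UBall X → ℂ) := ⟨fun f => f.1⟩

theorem coe_zero : ((0 : HL0 X) : UBall X → ℂ) = 0 := rfl

theorem coe_add (f g : HL0 X) : ((f + g : HL0 X) : UBall X → ℂ) = f + g := rfl

theorem coe_neg (f : HL0 X) : ((-f : HL0 X) : UBall X → ℂ) = -f := rfl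

theorem coe_smul (c : ℂ) (f : HL0 X) : ((c • f : HL0 X) : UBall X → ℂ) = c • ⇑f := rfl

theorem map_zero (f : HL0 X) : f (UBall.zero X) = 0 := f.2.1.1

/-- The set of difference quotients of `f`. -/
def quotients (f : HL0 X) : Set ℝ :=
  {r | ∃ x y : UBall X, x ≠ y ∧ r = ‖f x - f y‖ / ‖(x : X) - y‖}

/-- The norm `L(f)`: the best Lipschitz constant. -/
instance : Norm (HL0 X) := ⟨fun f => sSup (quotients f)⟩

theorem norm_def (f : HL0 X) : ‖f‖ = sSup (quotients f) := rfl

theorem bddAbove_quotients (f : HL0 X) : BddAbove (quotients f) := by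
  obtain ⟨K, hK⟩ := f.2.1.2
  refine ⟨K, ?_⟩
  rintro r ⟨x, y, hxy, rfl⟩
  have hpos : 0 < ‖(x : X) - y‖ := norm_pos_iff.2 (sub_ne_zero.2 (Subtype.coe_injective.ne hxy))
  rw [div_le_iff₀ hpos, ← dist_eq_norm, ← dist_eq_norm]
  exact hK.dist_le_mul x y

theorem norm_nonneg' (f : HL0 X) : 0 ≤ ‖f‖ := by
  refine Real.sSup_nonneg ?_
  rintro r ⟨x, y, -, rfl⟩
  positivity

theorem norm_sub_le_norm_mul (f : HL0 X) (x y : UBall X) :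
    ‖f x - f y‖ ≤ ‖f‖ * ‖(x : X) - y‖ := by
  by_cases hxy : x = y
  · simp [hxy]
  · have hpos : 0 < ‖(x : X) - y‖ :=
      norm_pos_iff.2 (sub_ne_zero.2 (Subtype.coe_injective.ne hxy))
    rw [← div_le_iff₀ hpos]
    exact le_csSup (bddAbove_quotients f) ⟨x, y, hxy, rfl⟩

theorem norm_le_of_forall (f : HL0 X) {C : ℝ} (hC : 0 ≤ C)
    (h : ∀ x y : UBall X, ‖f x - f y‖ ≤ C * ‖(x : X) - y‖) : ‖f‖ ≤ C := by
  refine Real.sSup_le ?_ hC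
  rintro r ⟨x, y, hxy, rfl⟩
  have hpos : 0 < ‖(x : X) - y‖ := norm_pos_iff.2 (sub_ne_zero.2 (Subtype.coe_injective.ne hxy))
  rw [div_le_iff₀ hpos]
  exact h x y

theorem norm_apply_le (f : HL0 X) (x : UBall X) : ‖f x‖ ≤ ‖f‖ := by
  have h := norm_sub_le_norm_mul f x (UBall.zero X)
  rw [map_zero, sub_zero] at h
  have hx : ‖(x : X) - (UBall.zero X : X)‖ ≤ 1 := by
    have := x.2
    rw [mem_ball_zero_iff] at this
    simpa [UBall.zero] using this.le
  exact h.trans (mul_le_of_le_one_right (norm_nonneg' f) hx)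

theorem norm_smul_le' (c : ℂ) (f : HL0 X) : ‖c • f‖ ≤ ‖c‖ * ‖f‖ := by
  refine norm_le_of_forall _ (mul_nonneg (norm_nonneg c) (norm_nonneg' f)) fun x y => ?_
  rw [coe_smul, Pi.smul_apply, Pi.smul_apply, ← smul_sub, norm_smul, mul_assoc]
  exact mul_le_mul_of_nonneg_left (norm_sub_le_norm_mul f x y) (norm_nonneg c)

instance : NormedAddCommGroup (HL0 X) :=
  AddGroupNorm.toNormedAddCommGroup
    { toFun := fun f => ‖f‖
      map_zero' := le_antisymm
        (norm_le_of_forall _ le_rfl fun x y => by simp [coe_zero]) (norm_nonneg' _)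
      add_le' := fun f g => by
        refine norm_le_of_forall _ (add_nonneg (norm_nonneg' f) (norm_nonneg' g)) fun x y => ?_
        rw [coe_add, Pi.add_apply, Pi.add_apply, add_sub_add_comm, add_mul]
        exact (norm_add_le _ _).trans
          (add_le_add (norm_sub_le_norm_mul f x y) (norm_sub_le_norm_mul g x y))
      neg' := fun f => by
        have h : ∀ g : HL0 X, ‖-g‖ ≤ ‖g‖ := fun g => by
          have := norm_smul_le' (-1 : ℂ) g
          simpa using this
        exact le_antisymm (h f) (by simpa using h (-f))
      eq_zero_of_map_eq_zero' := fun f hf => by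
        refine Subtype.ext (funext fun x => ?_)
        have h := norm_apply_le f x
        have hf' : ‖f‖ = 0 := hf
        rw [hf'] at h
        exact norm_le_zero_iff.1 h }

theorem norm_eq_sSup (f : HL0 X) :
    ‖f‖ = sSup {r | ∃ x y : UBall X, x ≠ y ∧ r = ‖f x - f y‖ / ‖(x : X) - y‖} := rfl

instance : NormedSpace ℂ (HL0 X) := ⟨norm_smul_le'⟩

theorem continuous_coe (f : HL0 X) : Continuous (f : UBall X → ℂ) := by
  obtain ⟨K, hK⟩ := f.2.1.2
  exact hK.continuous

/-- A holomorphic Lipschitz function as a bundled continuous map. -/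
def toContinuousMap (f : HL0 X) : C(UBall X, ℂ) := ⟨f, continuous_coe f⟩

variable (X)

/-- The compact-open topology `τ₀` on `HL_0(B_X)`. -/
@[reducible] def tau0 : TopologicalSpace (HL0 X) :=
  TopologicalSpace.induced toContinuousMap ContinuousMap.compactOpen

end HL0

/-- `G_0(B_X)`: the functionals `φ` in the normed dual of `HL_0(B_X)` whose restriction to the
closed unit ball of `HL_0(B_X)` is `τ₀`-continuous. It carries the norm of the dual space. -/
def G0 : Submodule ℂ (StrongDual ℂ (HL0 X)) where
  carrier := {φ | @ContinuousOn _ _ (HL0.tau0 X) _ φ (closedBall (0 : HL0 X) 1)}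
  zero_mem' := @continuousOn_const _ _ (HL0.tau0 X) _ _ _
  add_mem' := fun {φ ψ} hφ hψ => @ContinuousOn.add _ _ _ _ _ (HL0.tau0 X) φ ψ _ hφ hψ
  smul_mem' := fun c φ hφ =>
    @ContinuousOn.const_smul _ _ _ _ _ _ (HL0.tau0 X) φ _ hφ c

variable {X}

/-- Evaluation at `x`, as an element of the dual of `HL_0(B_X)`. -/
def evalDual (x : UBall X) : StrongDual ℂ (HL0 X) :=
  LinearMap.mkContinuous
    { toFun := fun f => f x
      map_add' := fun _ _ => rfl
      map_smul' := fun _ _ => rfl } 1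
    fun f => by rw [one_mul]; exact HL0.norm_apply_le f x

theorem evalDual_apply (x : UBall X) (f : HL0 X) : evalDual x f = f x := rfl

theorem evalDual_mem (x : UBall X) : evalDual x ∈ G0 X := by
  have h : @Continuous _ _ (HL0.tau0 X) _ (fun f : HL0 X => HL0.toContinuousMap f x) :=
    @Continuous.comp _ _ _ (HL0.tau0 X) _ _ _ _ (ContinuousEvalConst.continuous_eval_const x)
      continuous_induced_dom
  exact @Continuous.continuousOn _ _ (HL0.tau0 X) _ _ _ h

/-- The map `δ : B_X → G_0(B_X)`, `δ(x)(f) = f(x)`. -/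
def delta (x : UBall X) : G0 X := ⟨evalDual x, evalDual_mem x⟩

variable (X)

/-- The derivative `dδ(0) : X → G_0(B_X)`. -/
def dDelta0 : X →L[ℂ] G0 X := fderiv ℂ (ext (delta (X := X))) 0

end HolLip

end

noncomputable section

namespace HolLip

open Filter Topology

/-! ### The derivative of the evaluation map at the origin. -/

section Derivative

variable {X : Type*} [NormedAddCommGroup X] [NormedSpace ℂ X]

/-! Restriction to the ball sends `X^*` contractively into `HL_0(B_X)`, and `f ↦ df(0)` is a
contractive left inverse. Everything follows by dualizing these two maps. The dual of `f ↦ df(0)`,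
restricted to `X`, is `derivDual`. The Schwarz estimate `HL0.norm_ext_sub_fderiv_le` is uniform over
the unit ball of `HL_0(B_X)`, so `derivDual` is the derivative of `δ` at `0` in the dual norm; since
`G_0(B_X)` is norm closed (`isClosed_G0`), it takes values there. Hahn-Banach makes it isometric.
The dual of restriction is `toBidual`, which sends `δ(x)` to the canonical image of `x` in `X^{**}`.
The `δ(x)` span a dense subspace (`dense_span_range_delta`) and the complete space `X` is closed in
`X^{**}`, so `toBidual` takes values in `X`; this is `T_Id`, and density gives its uniqueness. Both
operators are contractive and `T_Id ∘ dδ(0) = id`, whence the claims on `P`. -/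

theorem HL0.differentiableAt_zero (f : HL0 X) : DifferentiableAt ℂ (ext f) 0 :=
  f.2.2.1.differentiableAt (ball_mem_nhds 0 one_pos)

theorem ext_apply_of_mem {Y : Type*} (f : UBall X → Y) [NormedAddCommGroup Y] [NormedSpace ℂ Y]
    {x : X} (hx : x ∈ ball (0 : X) 1) : ext f x = f ⟨x, hx⟩ :=
  ext_apply f ⟨x, hx⟩

theorem HL0.ext_zero (f : HL0 X) : ext f 0 = 0 :=
  (ext_apply f (UBall.zero X)).trans f.map_zero

theorem HL0.norm_ext_le (f : HL0 X) {x : X} (hx : x ∈ ball (0 : X) 1) :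
    ‖ext f x‖ ≤ ‖f‖ * ‖x‖ := by
  have h := f.norm_sub_le_norm_mul ⟨x, hx⟩ (UBall.zero X)
  rw [f.map_zero, sub_zero] at h
  simpa [ext_apply_of_mem f hx, UBall.zero] using h

theorem HL0.norm_fderiv_zero_le (f : HL0 X) : ‖fderiv ℂ (ext f) 0‖ ≤ ‖f‖ := by
  refine f.differentiableAt_zero.hasFDerivAt.le_of_lip' (norm_nonneg f) ?_
  filter_upwards [ball_mem_nhds (0 : X) one_pos] with x hx
  rw [f.ext_zero, sub_zero, sub_zero]
  exact f.norm_ext_le hx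

/-- The second-order Schwarz estimate at the origin. -/
theorem HL0.norm_ext_sub_fderiv_le (f : HL0 X) {x : X} (hx : x ∈ ball (0 : X) 1) :
    ‖ext f x - fderiv ℂ (ext f) 0 x‖ ≤ 2 * ‖f‖ * ‖x‖ ^ 2 := by
  set g : X → ℂ := fun y => ext f y - fderiv ℂ (ext f) 0 y with hg
  have hg0 : g 0 = 0 := by simp [hg, f.ext_zero]
  have hd : DifferentiableOn ℂ g (ball 0 1) :=
    f.2.2.1.sub (fderiv ℂ (ext f) 0).differentiable.differentiableOn
  have hm : MapsTo g (ball 0 1) (closedBall (g 0) (2 * ‖f‖)) := by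
    intro y hy
    have hy1 : ‖y‖ ≤ 1 := (mem_ball_zero_iff.1 hy).le
    rw [hg0, mem_closedBall_zero_iff]
    calc ‖g y‖ ≤ ‖ext f y‖ + ‖fderiv ℂ (ext f) 0 y‖ := norm_sub_le _ _
      _ ≤ ‖f‖ * ‖y‖ + ‖f‖ * ‖y‖ :=
        add_le_add (f.norm_ext_le hy)
          ((fderiv ℂ (ext f) 0).le_of_opNorm_le f.norm_fderiv_zero_le y)
      _ ≤ ‖f‖ * 1 + ‖f‖ * 1 := by gcongr
      _ = 2 * ‖f‖ := by ring
  -- Vanishing to order above 1 lets the Schwarz lemma gain the exponent 1 + 1 = 2, with the sup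
  -- bound `2 * ‖f‖` as constant.
  have ho : (fun y => g y - g 0) =o[𝓝 0] (fun y => ‖y - 0‖ ^ 1) := by
    have h := f.differentiableAt_zero.hasFDerivAt.isLittleO
    simpa [hg, f.ext_zero] using h.norm_right
  have h := Complex.dist_le_mul_div_pow_of_mapsTo_ball_of_isLittleO hd hm ho hx
  simpa [hg0] using h

variable (X) in
/-- The map sending `x` to the functional `f ↦ df(0)(x)` on `HL_0(B_X)`. -/
def derivDual : X →L[ℂ] StrongDual ℂ (HL0 X) :=
  LinearMap.mkContinuous₂
    (LinearMap.mk₂ ℂ (fun (x : X) (f : HL0 X) => fderiv ℂ (ext f) 0 x)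
      (fun x y f => map_add _ x y) (fun c x f => map_smul _ c x)
      (fun x f g => by
        rw [HL0.coe_add, ext_add,
          fderiv_add f.differentiableAt_zero g.differentiableAt_zero]
        rfl)
      (fun c x f => by
        rw [HL0.coe_smul, ext_smul, fderiv_const_smul f.differentiableAt_zero]
        rfl)) 1
    (fun x f => by
      rw [one_mul, mul_comm]
      exact (fderiv ℂ (ext f) 0).le_of_opNorm_le f.norm_fderiv_zero_le x)

theorem derivDual_apply (x : X) (f : HL0 X) : derivDual X x f = fderiv ℂ (ext f) 0 x := rfl

theorem norm_derivDual_apply_le (x : X) : ‖derivDual X x‖ ≤ ‖x‖ := by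
  refine ContinuousLinearMap.opNorm_le_bound _ (norm_nonneg x) fun f => ?_
  rw [mul_comm]
  exact (fderiv ℂ (ext f) 0).le_of_opNorm_le f.norm_fderiv_zero_le x

theorem evalDual_zero : evalDual (UBall.zero X) = 0 := by
  ext f
  exact f.map_zero

theorem norm_evalDual_sub_derivDual_le (x : UBall X) :
    ‖evalDual x - derivDual X x‖ ≤ 2 * ‖(x : X)‖ ^ 2 := by
  refine ContinuousLinearMap.opNorm_le_bound _ (by positivity) fun f => ?_
  have h := f.norm_ext_sub_fderiv_le x.2
  rw [ext_apply] at h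
  calc ‖(evalDual x - derivDual X x) f‖ ≤ 2 * ‖f‖ * ‖(x : X)‖ ^ 2 := h
    _ = 2 * ‖(x : X)‖ ^ 2 * ‖f‖ := by ring

variable (X) in
theorem hasFDerivAt_ext_evalDual :
    HasFDerivAt (ext (evalDual (X := X))) (derivDual X) 0 := by
  rw [hasFDerivAt_iff_isLittleO_nhds_zero]
  have h0 : ext (evalDual (X := X)) 0 = 0 :=
    (ext_apply evalDual (UBall.zero X)).trans evalDual_zero
  have hO : (fun x : X => ext evalDual (0 + x) - ext evalDual 0 - derivDual X x)
      =O[𝓝 0] fun x => ‖x‖ ^ 2 := by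
    refine Asymptotics.IsBigO.of_bound 2 ?_
    filter_upwards [ball_mem_nhds (0 : X) one_pos] with x hx
    rw [zero_add, h0, sub_zero, ext_apply_of_mem evalDual hx, norm_pow, norm_norm]
    exact norm_evalDual_sub_derivDual_le ⟨x, hx⟩
  refine hO.trans_isLittleO ?_
  exact (Asymptotics.isLittleO_norm_pow_id one_lt_two)

variable (X) in
-- Norm convergence of functionals is uniform convergence on the unit ball, which preserves
-- `τ₀`-continuity there.
theorem isClosed_G0 : IsClosed (G0 X : Set (StrongDual ℂ (HL0 X))) := by
  refine isClosed_of_closure_subset fun φ hφ => ?_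
  refine @continuousOn_of_uniform_approx_of_continuousOn _ _ (HL0.tau0 X) _ _ _ fun u hu => ?_
  obtain ⟨ε, hε, hu⟩ := Metric.mem_uniformity_dist.1 hu
  obtain ⟨ψ, hψ, hd⟩ := Metric.mem_closure_iff.1 hφ ε hε
  refine ⟨ψ, hψ, fun f hf => hu ?_⟩
  rw [dist_eq_norm] at hd ⊢
  rw [mem_closedBall_zero_iff] at hf
  calc ‖φ f - ψ f‖ = ‖(φ - ψ) f‖ := rfl
    _ ≤ ‖φ - ψ‖ * ‖f‖ := (φ - ψ).le_opNorm f
    _ ≤ ‖φ - ψ‖ := mul_le_of_le_one_right (norm_nonneg _) hf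
    _ < ε := hd

/-- Points outside the ball matter because the difference quotients below run over all `n`,
including small ones. -/
theorem ext_evalDual_mem (x : X) : ext evalDual x ∈ G0 X := by
  by_cases hx : x ∈ ball (0 : X) 1
  · rw [ext_apply_of_mem evalDual hx]
    exact evalDual_mem _
  · have : ext (evalDual (X := X)) x = 0 :=
      Function.extend_apply' _ _ _ fun ⟨y, hy⟩ => hx (hy ▸ y.2)
    rw [this]
    exact zero_mem _

/-- The functional is the norm limit of the quotients `n (δ(x/n) - δ(0))`, and `G_0(B_X)` is closed.
-/
theorem derivDual_mem (x : X) : derivDual X x ∈ G0 X := by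
  have hlim := (hasFDerivAt_ext_evalDual X).lim x (c := fun n : ℕ => (n : ℂ)) (l := atTop)
    (by simpa using tendsto_natCast_atTop_atTop)
  exact (isClosed_G0 X).mem_of_tendsto hlim <| Eventually.of_forall fun n =>
    (G0 X).smul_mem _ ((G0 X).sub_mem (ext_evalDual_mem _) (ext_evalDual_mem _))

theorem coe_ext_delta (x : X) : ((ext delta x : G0 X) : StrongDual ℂ (HL0 X)) =
    ext evalDual x := by
  by_cases hx : x ∈ ball (0 : X) 1
  · rw [ext_apply_of_mem evalDual hx, ext_apply_of_mem delta hx]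
    rfl
  · have h : ¬ ∃ y : UBall X, (y : X) = x := fun ⟨y, hy⟩ => hx (hy ▸ y.2)
    rw [ext, ext, Function.extend_apply' _ _ _ h, Function.extend_apply' _ _ _ h]
    rfl

variable (X) in
theorem hasFDerivAt_ext_delta :
    HasFDerivAt (ext (delta (X := X))) ((derivDual X).codRestrict (G0 X) derivDual_mem) 0 := by
  rw [hasFDerivAt_iff_isLittleO_nhds_zero]
  have h := hasFDerivAt_iff_isLittleO_nhds_zero.1 (hasFDerivAt_ext_evalDual X)
  refine (Asymptotics.isLittleO_norm_left.1 ?_)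
  refine (Asymptotics.isLittleO_norm_left.2 h).congr_left fun x => ?_
  rw [← Submodule.norm_coe (_ - _ - _), Submodule.coe_sub, Submodule.coe_sub, coe_ext_delta,
    coe_ext_delta]
  rfl

theorem coe_dDelta0_apply (x : X) : (dDelta0 X x : StrongDual ℂ (HL0 X)) = derivDual X x := by
  rw [dDelta0, (hasFDerivAt_ext_delta X).fderiv]
  rfl

end Derivative

/-! ### Restricting linear functionals to the ball; the isometry. -/

section Dual

variable {X : Type*} [NormedAddCommGroup X] [NormedSpace ℂ X]

/-- The restriction of a continuous linear functional to the unit ball. -/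
def HL0.ofDual (g : StrongDual ℂ X) : HL0 X :=
  ⟨fun x => g x,
    ⟨_root_.map_zero g, ‖g‖₊ * 1, g.lipschitz.comp (LipschitzWith.subtype_val _)⟩,
    g.differentiable.differentiableOn.congr fun _ hx => ext_apply_of_mem _ hx,
    ‖g‖, fun x => g.unit_le_opNorm x (mem_ball_zero_iff.1 x.2).le⟩

theorem HL0.ofDual_apply (g : StrongDual ℂ X) (x : UBall X) : HL0.ofDual g x = g x := rfl

theorem HL0.norm_ofDual_le (g : StrongDual ℂ X) : ‖HL0.ofDual g‖ ≤ ‖g‖ :=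
  HL0.norm_le_of_forall _ (norm_nonneg g) fun x y => by
    rw [ofDual_apply, ofDual_apply, ← map_sub]
    exact g.le_opNorm _

theorem HL0.fderiv_ofDual (g : StrongDual ℂ X) : fderiv ℂ (ext (HL0.ofDual g)) 0 = g := by
  have h : ext (HL0.ofDual g) =ᶠ[𝓝 0] g := by
    filter_upwards [ball_mem_nhds (0 : X) one_pos] with x hx
    exact ext_apply_of_mem _ hx
  rw [h.fderiv_eq, g.fderiv]

variable (X) in
/-- The restriction map `X^* → HL_0(B_X)` as a bounded linear operator. -/
def HL0.ofDualL : StrongDual ℂ X →L[ℂ] HL0 X :=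
  LinearMap.mkContinuous
    { toFun := HL0.ofDual
      map_add' := fun _ _ => rfl
      map_smul' := fun _ _ => rfl } 1
    fun g => by rw [one_mul]; exact HL0.norm_ofDual_le g

theorem norm_dDelta0_apply (x : X) : ‖dDelta0 X x‖ = ‖x‖ := by
  rw [← Submodule.norm_coe, coe_dDelta0_apply]
  refine le_antisymm (norm_derivDual_apply_le x) ?_
  -- A norming functional with only `‖g‖ ≤ 1`, which also covers `x = 0`.
  obtain ⟨g, hg, hgx⟩ := exists_dual_vector'' ℂ x
  have h := (derivDual X x).unit_le_opNorm (HL0.ofDual g) ((HL0.norm_ofDual_le g).trans hg)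
  rw [derivDual_apply, HL0.fderiv_ofDual, hgx] at h
  simpa using h

end Dual

/-! ### Density of the span of the evaluations. -/

section Density

variable {X : Type*} [NormedAddCommGroup X] [NormedSpace ℂ X]

theorem exists_isCompact_of_mem_G0 {φ : StrongDual ℂ (HL0 X)} (hφ : φ ∈ G0 X) {ε : ℝ}
    (hε : 0 < ε) : ∃ K : Set (UBall X), IsCompact K ∧ ∃ η : ℝ, 0 < η ∧
      ∀ f : HL0 X, ‖f‖ ≤ 1 → (∀ x ∈ K, ‖f x‖ < η) → ‖φ f‖ < ε := by
  have h0 : (0 : HL0 X) ∈ closedBall (0 : HL0 X) 1 := mem_closedBall_self zero_le_one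
  have hU : ball (φ 0) ε ∈ 𝓝 (φ 0) := ball_mem_nhds _ hε
  have h := @ContinuousWithinAt.preimage_mem_nhdsWithin _ _ (HL0.tau0 X) _ _ _ _ _ (hφ 0 h0) hU
  obtain ⟨u, hu, hsub⟩ := (@mem_nhdsWithin_iff_exists_mem_nhds_inter _ (HL0.tau0 X) _ _ _).1 h
  rw [nhds_induced, Filter.mem_comap] at hu
  obtain ⟨V, hV, hVu⟩ := hu
  have hb := (Metric.nhds_basis_ball (x := (0 : ℂ))).nhds_continuousMapConst (X := UBall X)
  obtain ⟨⟨K, η⟩, ⟨hK, hη⟩, hKV⟩ := hb.mem_iff.1 (show V ∈ 𝓝 (ContinuousMap.const _ 0) from hV)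
  refine ⟨K, hK, η, hη, fun f hf hfK => ?_⟩
  have hfu : f ∈ u := hVu (hKV fun x hx => mem_ball_zero_iff.2 (hfK x hx))
  simpa using hsub ⟨hfu, mem_closedBall_zero_iff.2 hf⟩

/-- A functional in `G_0(B_X)` is small on the functions vanishing on a suitable finite set. -/
theorem exists_finite_norm_le_of_mem_G0 {φ : StrongDual ℂ (HL0 X)} (hφ : φ ∈ G0 X) {ε : ℝ}
    (hε : 0 < ε) : ∃ s : Set (UBall X), s.Finite ∧
      ∀ f : HL0 X, (∀ x ∈ s, f x = 0) → ‖φ f‖ ≤ ε * ‖f‖ := by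
  obtain ⟨K, hK, η, hη, h⟩ := exists_isCompact_of_mem_G0 hφ hε
  -- A function with Lipschitz constant at most 1 that vanishes at the centres of an `η`-cover is
  -- below `η` on all of `K`.
  obtain ⟨s, -, hs, hKs⟩ := hK.finite_cover_balls hη
  have key : ∀ f : HL0 X, ‖f‖ ≤ 1 → (∀ x ∈ s, f x = 0) → ‖φ f‖ < ε := by
    intro f hf hfs
    refine h f hf fun x hx => ?_
    obtain ⟨y, hy, hxy⟩ := mem_iUnion₂.1 (hKs hx)
    have hle := f.norm_sub_le_norm_mul x y
    rw [hfs y hy, sub_zero] at hle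
    refine hle.trans_lt ((mul_le_of_le_one_left (norm_nonneg _) hf).trans_lt ?_)
    rw [← dist_eq_norm]
    exact hxy
  refine ⟨s, hs, fun f hfs => ?_⟩
  rcases eq_or_ne f 0 with rfl | hf0
  · simp
  have hpos : 0 < ‖f‖ := norm_pos_iff.2 hf0
  have hk := key (((‖f‖⁻¹ : ℝ) : ℂ) • f) (by
      rw [norm_smul, Complex.norm_real, norm_inv, norm_norm, inv_mul_cancel₀ hpos.ne'])
    fun x hx => by rw [HL0.coe_smul, Pi.smul_apply, hfs x hx, smul_zero]
  rw [map_smul, norm_smul, Complex.norm_real, norm_inv, norm_norm, inv_mul_lt_iff₀ hpos,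
    mul_comm] at hk
  exact hk.le

variable (X) in
-- On the common kernel `M` of finitely many evaluations `φ` has small norm. A norm-preserving
-- extension `ψ` of `φ|_M` is then small, and `φ - ψ` kills `M`, hence is a combination of those
-- evaluations within `‖ψ‖` of `φ`.
theorem dense_span_range_delta :
    Dense (Submodule.span ℂ (range (delta (X := X))) : Set (G0 X)) := by
  intro φ
  refine Metric.mem_closure_iff.2 fun ε hε => ?_
  obtain ⟨s, hs, h⟩ := exists_finite_norm_le_of_mem_G0 φ.2 (half_pos hε)
  have : Finite s := hs
  let L : s → HL0 X →ₗ[ℂ] ℂ := fun x => (evalDual (x : UBall X)).toLinearMap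
  let M : Submodule ℂ (HL0 X) := ⨅ x, LinearMap.ker (L x)
  have hM : ∀ f ∈ M, ∀ x ∈ s, f x = 0 := fun f hf x hx =>
    (Submodule.mem_iInf _).1 hf ⟨x, hx⟩
  obtain ⟨ψ, hψ, hψn⟩ := exists_extension_norm_eq M ((φ : StrongDual ℂ (HL0 X)).comp M.subtypeL)
  have hψε : ‖ψ‖ ≤ ε / 2 := by
    rw [hψn]
    exact ContinuousLinearMap.opNorm_le_bound _ (half_pos hε).le fun f => h f (hM f f.2)
  have hker : ⨅ x, LinearMap.ker (L x) ≤
      LinearMap.ker ((φ : StrongDual ℂ (HL0 X)) - ψ).toLinearMap := by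
    intro f hf
    have := hψ ⟨f, hf⟩
    simpa [sub_eq_zero] using this.symm
  have hfin := Fintype.ofFinite s
  obtain ⟨c, hc⟩ := (Submodule.mem_span_range_iff_exists_fun ℂ).1
    (mem_span_of_iInf_ker_le_ker hker)
  refine ⟨∑ x, c x • delta (x : UBall X),
    Submodule.sum_mem _ fun x _ => Submodule.smul_mem _ _ (Submodule.subset_span ⟨_, rfl⟩), ?_⟩
  have hsum : ((∑ x, c x • delta (x : UBall X) : G0 X) : StrongDual ℂ (HL0 X)) = φ - ψ := by
    ext f
    have := LinearMap.congr_fun hc f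
    simpa [L, LinearMap.sum_apply, _root_.sum_apply, delta] using this
  rw [dist_eq_norm, ← Submodule.norm_coe, Submodule.coe_sub, hsum, sub_sub_cancel]
  linarith

end Density

/-! ### The operator `T_Id`, built through the bidual. -/

section Linearization

open NormedSpace

variable (X : Type*) [NormedAddCommGroup X] [NormedSpace ℂ X]

/-- The operator `G_0(B_X) → X^{**}` obtained by restricting functionals to `X^*`. -/
def toBidual : G0 X →L[ℂ] StrongDual ℂ (StrongDual ℂ X) :=
  LinearMap.mkContinuous
    { toFun := fun φ => (φ : StrongDual ℂ (HL0 X)).comp (HL0.ofDualL X)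
      map_add' := fun _ _ => rfl
      map_smul' := fun _ _ => rfl } 1
    fun φ => by
      rw [one_mul]
      refine ContinuousLinearMap.opNorm_le_bound _ (norm_nonneg φ) fun g => ?_
      exact ((φ : StrongDual ℂ (HL0 X)).le_opNorm _).trans
        (mul_le_mul_of_nonneg_left (HL0.norm_ofDual_le g) (norm_nonneg φ))

variable {X}

theorem toBidual_apply (φ : G0 X) (g : StrongDual ℂ X) :
    toBidual X φ g = (φ : StrongDual ℂ (HL0 X)) (HL0.ofDual g) := rfl

variable (X) in
theorem norm_toBidual_le : ‖toBidual X‖ ≤ 1 := LinearMap.mkContinuous_norm_le _ zero_le_one _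

theorem toBidual_delta (x : UBall X) :
    toBidual X (delta x) = inclusionInDoubleDualLi ℂ (x : X) := rfl

theorem toBidual_dDelta0 (x : X) :
    toBidual X (dDelta0 X x) = inclusionInDoubleDualLi ℂ x := by
  ext g
  rw [toBidual_apply, coe_dDelta0_apply, derivDual_apply, HL0.fderiv_ofDual]
  rfl

/-- The range is closed because `X` is complete and embeds isometrically; it contains the images of
all `δ(x)`, so density suffices. -/
theorem toBidual_mem_range [CompleteSpace X] (φ : G0 X) :
    toBidual X φ ∈ LinearMap.range (inclusionInDoubleDualLi ℂ (E := X)).toLinearMap := by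
  set R := LinearMap.range (inclusionInDoubleDualLi ℂ (E := X)).toLinearMap
  have hR : IsClosed (R : Set (StrongDual ℂ (StrongDual ℂ X))) :=
    (inclusionInDoubleDualLi ℂ (E := X)).isometry.isClosedEmbedding.isClosed_range
  have hsub : (Submodule.span ℂ (range (delta (X := X))) : Set (G0 X)) ⊆ toBidual X ⁻¹' R := by
    have : Submodule.span ℂ (range (delta (X := X))) ≤ R.comap (toBidual X).toLinearMap :=
      Submodule.span_le.2 <| by
        rintro _ ⟨x, rfl⟩
        exact ⟨x, (toBidual_delta x).symm⟩
    exact this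
  exact closure_minimal hsub (hR.preimage (toBidual X).continuous) (dense_span_range_delta X φ)

variable (X) in
/-- The linearization `T_Id : G_0(B_X) → X` of the identity. -/
def linearizeId [CompleteSpace X] : G0 X →L[ℂ] X :=
  ((inclusionInDoubleDualLi ℂ (E := X)).equivRange.symm : _ →L[ℂ] X).comp
    ((toBidual X).codRestrict _ toBidual_mem_range)

theorem inclusion_linearizeId [CompleteSpace X] (φ : G0 X) :
    inclusionInDoubleDualLi ℂ (linearizeId X φ) = toBidual X φ :=
  congrArg Subtype.val ((inclusionInDoubleDualLi ℂ (E := X)).equivRange.apply_symm_apply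
    ⟨toBidual X φ, toBidual_mem_range φ⟩)

theorem norm_linearizeId_apply_le [CompleteSpace X] (φ : G0 X) : ‖linearizeId X φ‖ ≤ ‖φ‖ := by
  rw [← (inclusionInDoubleDualLi ℂ (E := X)).norm_map, inclusion_linearizeId]
  simpa using (toBidual X).le_of_opNorm_le (norm_toBidual_le X) φ

theorem linearizeId_delta [CompleteSpace X] (x : UBall X) : linearizeId X (delta x) = x :=
  (inclusionInDoubleDualLi ℂ (E := X)).injective <|
    (inclusion_linearizeId _).trans (toBidual_delta x)

theorem linearizeId_dDelta0 [CompleteSpace X] (x : X) : linearizeId X (dDelta0 X x) = x :=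
  (inclusionInDoubleDualLi ℂ (E := X)).injective <|
    (inclusion_linearizeId _).trans (toBidual_dDelta0 x)

end Linearization

end HolLip

end

theorem mainTheorem4 (X : Type*) [NormedAddCommGroup X] [NormedSpace ℂ X] [CompleteSpace X] :
    DifferentiableAt ℂ (HolLip.ext (HolLip.delta (X := X))) 0 ∧
    (∀ x : X, ‖HolLip.dDelta0 X x‖ = ‖x‖) ∧
    ∃ T : HolLip.G0 X →L[ℂ] X,
      (∀ x : HolLip.UBall X, T (HolLip.delta x) = x) ∧
      (∀ S : HolLip.G0 X →L[ℂ] X, (∀ x : HolLip.UBall X, S (HolLip.delta x) = x) → S = T) ∧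
      (HolLip.dDelta0 X ∘L T) ∘L (HolLip.dDelta0 X ∘L T) = HolLip.dDelta0 X ∘L T ∧
      Set.range (HolLip.dDelta0 X ∘L T) = Set.range (HolLip.dDelta0 X) ∧
      ‖HolLip.dDelta0 X ∘L T‖ ≤ 1 ∧
      (Nontrivial X → ‖HolLip.dDelta0 X ∘L T‖ = 1) := by
  have hle : ‖HolLip.dDelta0 X ∘L HolLip.linearizeId X‖ ≤ 1 := by
    refine ContinuousLinearMap.opNorm_le_bound _ zero_le_one fun φ => ?_
    rw [one_mul, ContinuousLinearMap.comp_apply, HolLip.norm_dDelta0_apply]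
    exact HolLip.norm_linearizeId_apply_le φ
  refine ⟨(HolLip.hasFDerivAt_ext_delta X).differentiableAt, HolLip.norm_dDelta0_apply,
    HolLip.linearizeId X, HolLip.linearizeId_delta, fun S hS => ?_, ?_, ?_, hle, fun _ => ?_⟩
  · refine ContinuousLinearMap.ext_on (HolLip.dense_span_range_delta X) ?_
    rintro _ ⟨x, rfl⟩
    rw [hS, HolLip.linearizeId_delta]
  · refine ContinuousLinearMap.ext fun φ => ?_
    simp only [ContinuousLinearMap.comp_apply, HolLip.linearizeId_dDelta0]
  · have hsurj : Function.Surjective (HolLip.linearizeId X) := fun x =>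
      ⟨_, HolLip.linearizeId_dDelta0 x⟩
    rw [ContinuousLinearMap.coe_comp, hsurj.range_comp]
  · refine le_antisymm hle ?_
    obtain ⟨x, hx⟩ := exists_ne (0 : X)
    -- The projection fixes the nonzero vector `dδ(0)(x)`, so its norm is at least 1.
    have h := (HolLip.dDelta0 X ∘L HolLip.linearizeId X).le_opNorm (HolLip.dDelta0 X x)
    rw [ContinuousLinearMap.comp_apply, HolLip.linearizeId_dDelta0,
      HolLip.norm_dDelta0_apply] at h
    exact (le_mul_iff_one_le_left (norm_pos_iff.2 hx)).1 h
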